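/- Let $M\ge 1$, $\tau\ge 0$ be integers and $\rho,\beta>0$. Let the uplink channel be i.i.d. Rayleigh fading, $\bm h=\sqrt{\beta}\,\bm z$ with $\bm z\sim\mathcal{CN}(\bm 0,\bm I_M)$, and let $\bm W\in\mathbb C^{M\times\tau}$, independent of $\bm z$, have independent $\mathcal{CN}(0,1)$ entries (so real and imaginary parts are independent with variance $1/2$). When the deterministic unit vector $\bm\phi\in\mathbb C^\tau$ is sent, the base station receives $\bm Y=\sqrt{\rho}\,\bm h\bm\phi^{\mathsf T}+\bm W$, and its detector maximizes $\|\bm Y\bm\psi^*\|$ over the candidate sequences $\bm\psi$ ($^*$ is the entrywise conjugate, $\|\cdot\|$ the Euclidean norm). For unit vectors $\bm\phi,\bm\phi'\in\mathbb C^\tau$ let $\mathrm{PEP}(\bm\phi,\bm\phi')=\Pr(\|\bm Y\bm\phi'^*\|>\|\bm Y\bm\phi^*\|)$ be the pairwise error probability in favor of $\bm\phi'$ when $\bm\phi$ is sent. For $a\in[0,1]$ let $$p(a)=\Pr\left(\left\|a\bm x+\sqrt{1-a^2}\,\bm y\right\|^2>\|\bm x\|^2\right),$$ where $\bm x\sim\mathcal{CN}(\bm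 0,(\rho\beta+1)\bm I_M)$ and $\bm y\sim\mathcal{CN}(\bm 0,\bm I_M)$ are independent. Then: 1. $\mathrm{PEP}(\bm\phi,\bm\phi')=p(|\bm\phi^{\mathsf H}\bm\phi'|)$ for all unit vectors $\bm\phi,\bm\phi'\in\mathbb C^\tau$. 2. $p$ is strictly increasing (in particular nondecreasing) on $[0,1)$. 3. Consequently, the pairwise error probability increases with $|\alpha|=|\bm\phi^{\mathsf H}\bm\phi'|<1$: if $\bm\phi_1,\bm\phi_1',\bm\phi_2,\bm\phi_2'\in\mathbb C^\tau$ are unit vectors with $|\bm\phi_1^{\mathsf H}\bm\phi_1'|<|\bm\phi_2^{\mathsf H}\bm\phi_2'|<1$, then $\mathrm{PEP}(\bm\phi_1,\bm\phi_1')<\mathrm{PEP}(\bm\phi_2,\bm\phi_2')$. -/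

import Mathlib

open MeasureTheory ProbabilityTheory
open scoped Matrix

noncomputable section

/-- The circularly symmetric complex normal law `CN(0, v)` for `v ≥ 0`: the real and the imaginary
part are independent real normal variables with mean `0` and variance `v / 2`. -/
def complexNormal (v : ℝ) : Measure ℂ :=
  ((gaussianReal 0 (v / 2).toNNReal).prod (gaussianReal 0 (v / 2).toNNReal)).map
    (fun p : ℝ × ℝ => (⟨p.1, p.2⟩ : ℂ))

/-- The law `CN(0, v I_M)` on `ℂ^M` (with its Euclidean norm): independent `CN(0, v)` entries. -/
def complexNormalVec (M : ℕ) (v : ℝ) : Measure (EuclideanSpace ℂ (Fin M)) :=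
  (Measure.pi (fun _ : Fin M => complexNormal v)).map (WithLp.toLp 2)

/-- The product σ-algebra on complex matrices, entry by entry. -/
instance instMeasurableSpaceComplexMatrix (M τ : ℕ) :
    MeasurableSpace (Matrix (Fin M) (Fin τ) ℂ) :=
  inferInstanceAs (MeasurableSpace (Fin M → Fin τ → ℂ))

/-- The law of an `M × τ` matrix with independent `CN(0, 1)` entries. -/
def noiseLaw (M τ : ℕ) : Measure (Matrix (Fin M) (Fin τ) ℂ) :=
  Measure.pi (fun _ : Fin M => Measure.pi (fun _ : Fin τ => complexNormal 1))

/-- The received signal `Y = √ρ h φᵀ + W`. -/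
def receivedSignal {M τ : ℕ} (ρ : ℝ) (h : EuclideanSpace ℂ (Fin M))
    (φ : EuclideanSpace ℂ (Fin τ)) (W : Matrix (Fin M) (Fin τ) ℂ) : Matrix (Fin M) (Fin τ) ℂ :=
  ((Real.sqrt ρ : ℝ) : ℂ) • Matrix.vecMulVec (WithLp.ofLp h) (WithLp.ofLp φ) + W

/-- The objective `‖Y φ*‖` (`φ*` is the entrywise conjugate, Euclidean norm on `ℂ^M`) that the
detector maximizes over the candidate sequences `φ`. -/
def detectorObjective {M τ : ℕ} (Y : Matrix (Fin M) (Fin τ) ℂ)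
    (φ : EuclideanSpace ℂ (Fin τ)) : ℝ :=
  ‖WithLp.toLp 2 (Y *ᵥ star (WithLp.ofLp φ))‖

/-- The pairwise error probability: `φ` is sent over the uplink channel `h` with noise `W`, and
the detector prefers the sequence `φ'`. -/
def pairwiseErrorProb {Ω : Type*} [MeasurableSpace Ω] (P : Measure Ω) {M τ : ℕ} (ρ : ℝ)
    (h : Ω → EuclideanSpace ℂ (Fin M)) (W : Ω → Matrix (Fin M) (Fin τ) ℂ)
    (φ φ' : EuclideanSpace ℂ (Fin τ)) : ℝ :=
  P.real {ω | detectorObjective (receivedSignal ρ (h ω) φ (W ω)) φ' >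
    detectorObjective (receivedSignal ρ (h ω) φ (W ω)) φ}

/-- `Pr(‖a x + √(1 - a²) y‖² > ‖x‖²)` for independent `x ∼ CN(0, (ρβ + 1) I_M)` and
`y ∼ CN(0, I_M)`. -/
def reducedErrorProb (M : ℕ) (ρ β a : ℝ) : ℝ :=
  ((complexNormalVec M (ρ * β + 1)).prod (complexNormalVec M 1)).real
    {p | ‖(a : ℂ) • p.1 + ((Real.sqrt (1 - a ^ 2) : ℝ) : ℂ) • p.2‖ ^ 2 > ‖p.1‖ ^ 2}

end

open scoped RealInnerProductSpace

/-! Projecting the received signal on an orthonormal pair `p`, `e` with `p` the conjugate of `φ`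
gives independent normal vectors of variances `ρβ + 1` and `1` (`map_projections`). A phase on the
conjugate of `φ'` does not affect the detector, so that sequence may be taken as `a p + √(1 - a²)
e`, which yields the reduced probability.

For monotonicity, put `s = √(1 - a²)`, `k² = ρβ + 1`. After division by `s`, the error event says
that a quadratic form in two standard normal vectors, with trace `s (1 - k²)` and determinant `-k²`,
is positive. A rotation preserves the normal law and diagonalizes the form, with eigenvalues `lam >
0` and `-mu < 0`. The event becomes `‖g.2‖² / ‖g.1‖² > mu / lam`. Since `lam * mu = k²` is free of
`a` and `mu - lam = s ρ β` falls as `a` grows, the threshold falls, and the tail of the ratio rises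
strictly. -/

instance isProbabilityMeasure_complexNormal (v : ℝ) : IsProbabilityMeasure (complexNormal v) :=
  Measure.isProbabilityMeasure_map Complex.measurableEquivRealProd.symm.measurable.aemeasurable

instance isProbabilityMeasure_complexNormalVec (M : ℕ) (v : ℝ) :
    IsProbabilityMeasure (complexNormalVec M v) :=
  Measure.isProbabilityMeasure_map (WithLp.measurable_toLp 2 _).aemeasurable

instance isProbabilityMeasure_noiseLaw (M τ : ℕ) : IsProbabilityMeasure (noiseLaw M τ) :=
  inferInstanceAs (IsProbabilityMeasure
    (Measure.pi (fun _ : Fin M => Measure.pi (fun _ : Fin τ => complexNormal 1))))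

/-! ### Characteristic functions and rotation invariance -/

theorem charFun_complexNormal {v : ℝ} (hv : 0 ≤ v) (t : ℂ) :
    charFun (complexNormal v) t = Complex.exp ((-(v / 4 * ‖t‖ ^ 2) : ℝ)) := by
  have hmap : complexNormal v =
      ((gaussianReal 0 (v / 2).toNNReal).prod (gaussianReal 0 (v / 2).toNNReal)).map
        Complex.measurableEquivRealProd.symm := rfl
  have h := integral_prod_mul (μ := gaussianReal 0 (v / 2).toNNReal)
    (ν := gaussianReal 0 (v / 2).toNNReal)
    (fun x : ℝ => Complex.exp (t.re * x * Complex.I))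
    (fun x : ℝ => Complex.exp (t.im * x * Complex.I))
  rw [← charFun_apply_real, ← charFun_apply_real, charFun_gaussianReal, charFun_gaussianReal] at h
  rw [charFun_apply, hmap, integral_map_equiv]
  convert h using 1
  · congr 1
    ext p
    rw [← Complex.exp_add]
    congr 1
    simp [Complex.inner, Complex.measurableEquivRealProd]
    ring
  · rw [← Complex.exp_add, Complex.sq_norm, Complex.normSq_apply, Real.coe_toNNReal _ (by positivity)]
    congr 1
    push_cast
    ring

theorem charFun_complexNormalVec (M : ℕ) {v : ℝ} (hv : 0 ≤ v) (t : EuclideanSpace ℂ (Fin M)) :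
    charFun (complexNormalVec M v) t = Complex.exp ((-(v / 4 * ‖t‖ ^ 2) : ℝ)) := by
  rw [complexNormalVec, charFun_pi]
  simp_rw [charFun_complexNormal hv]
  rw [← Complex.exp_sum, EuclideanSpace.norm_sq_eq, Finset.mul_sum, ← Finset.sum_neg_distrib]
  push_cast
  rfl

/-- The characteristic function of the noise, with the real inner product of matrices written out as
a double sum. -/
theorem integral_exp_noiseLaw (M τ : ℕ) (T : Matrix (Fin M) (Fin τ) ℂ) :
    ∫ W, Complex.exp ((∑ i, ∑ j, ⟪W i j, T i j⟫ : ℝ) * Complex.I) ∂(noiseLaw M τ) =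
      Complex.exp ((-(1 / 4 * ∑ i, ∑ j, ‖T i j‖ ^ 2) : ℝ)) := by
  have h : ∀ i, ∫ w : Fin τ → ℂ, ∏ j, Complex.exp ((⟪w j, T i j⟫ : ℝ) * Complex.I)
      ∂(Measure.pi fun _ : Fin τ => complexNormal 1) =
      Complex.exp ((-(1 / 4 * ∑ j, ‖T i j‖ ^ 2) : ℝ)) := by
    intro i
    rw [integral_fintype_prod_eq_prod
      (fun j (w : ℂ) => Complex.exp ((⟪w, T i j⟫ : ℝ) * Complex.I))]
    simp_rw [← charFun_apply, charFun_complexNormal zero_le_one]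
    rw [← Complex.exp_sum, Finset.mul_sum, ← Finset.sum_neg_distrib]
    push_cast
    rfl
  have h2 := integral_fintype_prod_eq_prod
    (μ := fun _ : Fin M => Measure.pi fun _ : Fin τ => complexNormal 1)
    (fun i (w : Fin τ → ℂ) => ∏ j, Complex.exp ((⟪w j, T i j⟫ : ℝ) * Complex.I))
  simp_rw [h] at h2
  rw [← Complex.exp_sum] at h2
  rw [Finset.mul_sum, ← Finset.sum_neg_distrib, Complex.ofReal_sum, ← h2]
  refine integral_congr_ae (Filter.Eventually.of_forall fun W => ?_)
  simp only [Complex.ofReal_sum, Finset.sum_mul, Complex.exp_sum]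

/-- A linear image of two independent standard complex normal vectors, with coefficients rotated
by an orthogonal matrix and the first component scaled. -/
theorem map_rotation_complexNormalVec (M : ℕ) (k C S : ℝ) (h : C ^ 2 + S ^ 2 = 1) :
    ((complexNormalVec M 1).prod (complexNormalVec M 1)).map
      (fun g => (k • (C • g.1 + S • g.2), C • g.2 - S • g.1)) =
      (complexNormalVec M (k ^ 2)).prod (complexNormalVec M 1) := by
  have hm : Measurable fun g : EuclideanSpace ℂ (Fin M) × EuclideanSpace ℂ (Fin M) =>
      (k • (C • g.1 + S • g.2), C • g.2 - S • g.1) := by fun_prop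
  have := Measure.isProbabilityMeasure_map (μ := (complexNormalVec M 1).prod (complexNormalVec M 1))
    hm.aemeasurable
  rw [← charFun_eq_prod_iff]
  intro t
  obtain ⟨t₁, t₂⟩ := t
  -- The two frequencies are the image of `(t₁, t₂)` under the adjoint of the linear map.
  have h2 := integral_prod_mul (μ := complexNormalVec M 1) (ν := complexNormalVec M 1)
    (fun x => Complex.exp (⟪x, (k * C) • t₁ - S • t₂⟫ * Complex.I))
    (fun x => Complex.exp (⟪x, (k * S) • t₁ + C • t₂⟫ * Complex.I))
  rw [← charFun_apply, ← charFun_apply, charFun_complexNormalVec _ zero_le_one,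
    charFun_complexNormalVec _ zero_le_one] at h2
  rw [charFun_complexNormalVec _ (sq_nonneg k), charFun_complexNormalVec _ zero_le_one,
    charFun_apply, ← MeasurableEquiv.coe_toLp, integral_map_equiv,
    integral_map hm.aemeasurable (by
      refine Continuous.aestronglyMeasurable ?_
      simp only [MeasurableEquiv.coe_toLp]
      fun_prop)]
  convert h2 using 1
  · congr 1
    ext g
    rw [← Complex.exp_add]
    congr 1
    simp only [MeasurableEquiv.coe_toLp, WithLp.prod_inner_apply, inner_add_left, inner_sub_left,
      inner_sub_right, inner_add_right, real_inner_smul_left, real_inner_smul_right]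
    push_cast
    ring
  · rw [← Complex.exp_add, ← Complex.exp_add]
    congr 1
    rw [← Complex.ofReal_add, ← Complex.ofReal_add]
    congr 1
    rw [norm_sub_sq_real, norm_add_sq_real]
    simp only [MeasurableEquiv.coe_toLp, norm_smul, mul_pow, real_inner_smul_left, real_inner_smul_right, Real.norm_eq_abs,
      sq_abs]
    linear_combination (-1 / 4 * (k ^ 2 * ‖t₁‖ ^ 2 + ‖t₂‖ ^ 2)) * -h

/-! ### Projections of the received signal -/

theorem inner_toLp_mulVec {M τ : ℕ} (W : Matrix (Fin M) (Fin τ) ℂ) (a : EuclideanSpace ℂ (Fin τ))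
    (t : EuclideanSpace ℂ (Fin M)) :
    ⟪WithLp.toLp 2 (W *ᵥ WithLp.ofLp a), t⟫ = ∑ i, ∑ j, ⟪W i j, star (a j) * t i⟫ := by
  rw [PiLp.inner_apply]
  refine Finset.sum_congr rfl fun i _ => ?_
  simp only [Matrix.mulVec, dotProduct, sum_inner]
  refine Finset.sum_congr rfl fun j _ => ?_
  simp [Complex.inner]
  ring

theorem measurable_toLp_mulVec {M τ : ℕ} (a : EuclideanSpace ℂ (Fin τ)) :
    Measurable fun W : Matrix (Fin M) (Fin τ) ℂ =>
      (WithLp.toLp 2 (W *ᵥ WithLp.ofLp a) : EuclideanSpace ℂ (Fin M)) := by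
  refine (WithLp.measurable_toLp 2 _).comp (measurable_pi_lambda _ fun i => ?_)
  simp only [Matrix.mulVec, dotProduct]
  refine Finset.measurable_sum _ fun j _ => Measurable.mul_const ?_ _
  exact (measurable_pi_apply j).comp (measurable_pi_apply (X := fun _ : Fin M => Fin τ → ℂ) i)

theorem measurable_projections {M τ : ℕ} (r : ℝ) (p e : EuclideanSpace ℂ (Fin τ)) :
    Measurable fun g : EuclideanSpace ℂ (Fin M) × Matrix (Fin M) (Fin τ) ℂ =>
      (r • g.1 + WithLp.toLp 2 (g.2 *ᵥ WithLp.ofLp p),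
        (WithLp.toLp 2 (g.2 *ᵥ WithLp.ofLp e) : EuclideanSpace ℂ (Fin M))) :=
  ((measurable_fst.const_smul r).add ((measurable_toLp_mulVec p).comp measurable_snd)).prodMk
    ((measurable_toLp_mulVec e).comp measurable_snd)

/-- Pythagoras in each row `i`, after conjugation. The absence of a cross term in `t₁`, `t₂` is what
makes the two projections independent. -/
theorem sum_norm_sq_outer {M τ : ℕ} {p e : EuclideanSpace ℂ (Fin τ)} (hp : ‖p‖ = 1) (he : ‖e‖ = 1)
    (hpe : inner ℂ p e = 0) (t₁ t₂ : EuclideanSpace ℂ (Fin M)) :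
    ∑ i, ∑ j, ‖star (p j) * t₁ i + star (e j) * t₂ i‖ ^ 2 = ‖t₁‖ ^ 2 + ‖t₂‖ ^ 2 := by
  rw [EuclideanSpace.norm_sq_eq t₁, EuclideanSpace.norm_sq_eq t₂, ← Finset.sum_add_distrib]
  refine Finset.sum_congr rfl fun i _ => ?_
  have h : ∑ j, ‖star (p j) * t₁ i + star (e j) * t₂ i‖ ^ 2 =
      ‖star (t₁ i) • p + star (t₂ i) • e‖ ^ 2 := by
    rw [EuclideanSpace.norm_sq_eq]
    refine Finset.sum_congr rfl fun j _ => ?_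
    rw [← norm_star]
    simp [mul_comm]
  rw [h, norm_add_sq (𝕜 := ℂ)]
  simp [inner_smul_left, inner_smul_right, hpe, norm_smul, hp, he]

/-- The law of the projections of `r z φᵀ + W` on two orthonormal sequences. -/
theorem map_projections (M τ : ℕ) (r : ℝ) {p e : EuclideanSpace ℂ (Fin τ)} (hp : ‖p‖ = 1)
    (he : ‖e‖ = 1) (hpe : inner ℂ p e = 0) :
    ((complexNormalVec M 1).prod (noiseLaw M τ)).map
      (fun g => (r • g.1 + WithLp.toLp 2 (g.2 *ᵥ WithLp.ofLp p),
        (WithLp.toLp 2 (g.2 *ᵥ WithLp.ofLp e) : EuclideanSpace ℂ (Fin M)))) =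
      (complexNormalVec M (r ^ 2 + 1)).prod (complexNormalVec M 1) := by
  have hm := measurable_projections (M := M) r p e
  have := Measure.isProbabilityMeasure_map (μ := (complexNormalVec M 1).prod (noiseLaw M τ))
    hm.aemeasurable
  rw [← charFun_eq_prod_iff]
  intro t
  obtain ⟨t₁, t₂⟩ := t
  have h2 := integral_prod_mul (μ := complexNormalVec M 1) (ν := noiseLaw M τ)
    (fun x => Complex.exp (⟪x, r • t₁⟫ * Complex.I))
    (fun W => Complex.exp ((∑ i, ∑ j, ⟪W i j, star (p j) * t₁ i + star (e j) * t₂ i⟫ : ℝ)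
      * Complex.I))
  rw [← charFun_apply, charFun_complexNormalVec _ zero_le_one,
    integral_exp_noiseLaw M τ (fun i j => star (p j) * t₁ i + star (e j) * t₂ i),
    sum_norm_sq_outer hp he hpe] at h2
  rw [charFun_complexNormalVec _ (by positivity), charFun_complexNormalVec _ zero_le_one,
    charFun_apply, ← MeasurableEquiv.coe_toLp, integral_map_equiv,
    integral_map hm.aemeasurable (by
      refine Continuous.aestronglyMeasurable ?_
      simp only [MeasurableEquiv.coe_toLp]
      fun_prop)]
  convert h2 using 1
  · congr 1
    ext g
    rw [← Complex.exp_add]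
    congr 1
    simp only [MeasurableEquiv.coe_toLp, WithLp.prod_inner_apply, inner_add_left,
      inner_toLp_mulVec, real_inner_smul_left, real_inner_smul_right, inner_add_right,
      Finset.sum_add_distrib]
    push_cast
    ring
  · rw [← Complex.exp_add, ← Complex.exp_add]
    congr 1
    rw [← Complex.ofReal_add, ← Complex.ofReal_add]
    congr 1
    simp only [MeasurableEquiv.coe_toLp, norm_smul, mul_pow, Real.norm_eq_abs, sq_abs]
    ring

/-! ### Strict decrease of the norm ratio tail -/

theorem isOpenPosMeasure_complexNormal {v : ℝ} (hv : 0 < v) :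
    (complexNormal v).IsOpenPosMeasure := by
  have hv' : (v / 2).toNNReal ≠ 0 := by simpa using hv
  have := (gaussianReal_absolutelyContinuous' 0 hv').isOpenPosMeasure
  exact Complex.equivRealProdCLM.symm.continuous.isOpenPosMeasure_map
    Complex.equivRealProdCLM.symm.surjective

theorem isOpenPosMeasure_complexNormalVec (M : ℕ) {v : ℝ} (hv : 0 < v) :
    (complexNormalVec M v).IsOpenPosMeasure := by
  have := isOpenPosMeasure_complexNormal hv
  exact (PiLp.continuous_toLp 2 _).isOpenPosMeasure_map (WithLp.toLp_surjective 2)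

/-- The probability that the ratio of the squared norms of two independent standard complex normal
vectors exceeds `t`. -/
noncomputable def normRatioTail (M : ℕ) (t : ℝ) : ℝ :=
  ((complexNormalVec M 1).prod (complexNormalVec M 1)).real {g | t * ‖g.1‖ ^ 2 < ‖g.2‖ ^ 2}

/-- The ratios strictly between two thresholds form a nonempty open event, which the normal law
charges. -/
theorem normRatioTail_strictAntiOn {M : ℕ} (hM : 0 < M) :
    StrictAntiOn (normRatioTail M) (Set.Ici 0) := by
  intro t₁ ht₁ t₂ ht₂ h
  have := isOpenPosMeasure_complexNormalVec M one_pos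
  have hsub : {g : EuclideanSpace ℂ (Fin M) × EuclideanSpace ℂ (Fin M) |
      t₂ * ‖g.1‖ ^ 2 < ‖g.2‖ ^ 2} ⊆ {g | t₁ * ‖g.1‖ ^ 2 < ‖g.2‖ ^ 2} := fun g hg =>
    (mul_le_mul_of_nonneg_right h.le (sq_nonneg _)).trans_lt hg
  have hopen : IsOpen {g : EuclideanSpace ℂ (Fin M) × EuclideanSpace ℂ (Fin M) |
      t₂ * ‖g.1‖ ^ 2 < ‖g.2‖ ^ 2} := isOpen_lt (by fun_prop) (by fun_prop)
  have hgap : IsOpen {g : EuclideanSpace ℂ (Fin M) × EuclideanSpace ℂ (Fin M) |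
      t₁ * ‖g.1‖ ^ 2 < ‖g.2‖ ^ 2 ∧ ‖g.2‖ ^ 2 < t₂ * ‖g.1‖ ^ 2} :=
    (isOpen_lt (by fun_prop) (by fun_prop)).and (isOpen_lt (by fun_prop) (by fun_prop))
  obtain ⟨m, hm₁, hm₂⟩ := exists_between h
  have hne : {g : EuclideanSpace ℂ (Fin M) × EuclideanSpace ℂ (Fin M) |
      t₁ * ‖g.1‖ ^ 2 < ‖g.2‖ ^ 2 ∧ ‖g.2‖ ^ 2 < t₂ * ‖g.1‖ ^ 2}.Nonempty := by
    refine ⟨(EuclideanSpace.single ⟨0, hM⟩ 1, EuclideanSpace.single ⟨0, hM⟩ (√m : ℂ)), ?_⟩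
    have hm₀ : 0 ≤ m := ht₁.out.trans hm₁.le
    simpa [Real.sq_sqrt hm₀] using ⟨hm₁, hm₂⟩
  have hpos := hgap.measure_pos ((complexNormalVec M 1).prod (complexNormalVec M 1)) hne
  rw [normRatioTail, normRatioTail, ← sub_pos, ← measureReal_sdiff hsub hopen.measurableSet]
  refine (ENNReal.toReal_pos hpos.ne' (measure_ne_top _ _)).trans_le (measureReal_mono ?_)
  exact fun g hg => ⟨hg.1, not_lt.2 hg.2.le⟩

/-! ### Diagonalization of the error event -/

/-- Simultaneous diagonalization of the quadratic form `-s k² X² + 2 a k X Y + s Y²` and the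
identity form. -/
theorem exists_rotation_diagonalizing {a s k lam : ℝ} (has : a ^ 2 + s ^ 2 = 1)
    (hlam : 0 < lam) (hs : 0 < s) (hk : 0 < k)
    (heq : lam ^ 2 + s * (k ^ 2 - 1) * lam = k ^ 2) :
    ∃ C S : ℝ, C ^ 2 + S ^ 2 = 1 ∧ -s * k ^ 2 * S ^ 2 + s * C ^ 2 + 2 * a * k * C * S = lam ∧
      -s * k ^ 2 * C ^ 2 + s * S ^ 2 - 2 * a * k * C * S = -(lam + s * (k ^ 2 - 1)) ∧
      -s * k ^ 2 * C * S - s * C * S + a * k * (C ^ 2 - S ^ 2) = 0 := by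
  -- `heq` is the characteristic equation of the form, and `(a k, q)` is an eigenvector for `lam`;
  -- normalized, it becomes `(S, C)`.
  obtain ⟨q, hq⟩ : ∃ q, q = lam + s * k ^ 2 := ⟨_, rfl⟩
  have hq₀ : 0 < q := by rw [hq]; positivity
  have hb : (a * k) ^ 2 = q * (lam - s) := by
    subst hq
    linear_combination k ^ 2 * has - heq
  have hr : 0 < (a * k) ^ 2 + q ^ 2 := by positivity
  obtain ⟨r, hr₀, hr₂⟩ : ∃ r : ℝ, 0 < r ∧ r ^ 2 = (a * k) ^ 2 + q ^ 2 :=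
    ⟨√((a * k) ^ 2 + q ^ 2), Real.sqrt_pos.2 hr, Real.sq_sqrt hr.le⟩
  have h₁ : (q / r) ^ 2 + (a * k / r) ^ 2 = 1 := by
    rw [div_pow, div_pow, ← add_div, div_eq_one_iff_eq (by positivity)]
    linarith
  have h₂ : -s * k ^ 2 * (a * k / r) ^ 2 + s * (q / r) ^ 2 + 2 * a * k * (q / r) * (a * k / r)
      = lam := by
    field_simp
    rw [hr₂]
    subst hq
    linear_combination (lam + s * k ^ 2) * hb
  refine ⟨q / r, a * k / r, h₁, h₂, ?_, ?_⟩
  -- The other eigenvalue is the trace minus `lam`.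
  · linear_combination (s - s * k ^ 2) * h₁ - h₂
  · field_simp
    subst hq
    linear_combination (-(a * k)) * hb

theorem normSq_smul_add_smul_lt_iff {E : Type*} [NormedAddCommGroup E] [InnerProductSpace ℝ E]
    {a s k lam C S : ℝ} (has : a ^ 2 + s ^ 2 = 1) (hs : 0 < s)
    (hlam : -s * k ^ 2 * S ^ 2 + s * C ^ 2 + 2 * a * k * C * S = lam)
    (hmu : -s * k ^ 2 * C ^ 2 + s * S ^ 2 - 2 * a * k * C * S = -(lam + s * (k ^ 2 - 1)))
    (hcross : -s * k ^ 2 * C * S - s * C * S + a * k * (C ^ 2 - S ^ 2) = 0) (x y : E) :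
    ‖k • (C • x + S • y)‖ ^ 2 < ‖a • (k • (C • x + S • y)) + s • (C • y - S • x)‖ ^ 2 ↔
      (lam + s * (k ^ 2 - 1)) * ‖x‖ ^ 2 < lam * ‖y‖ ^ 2 := by
  have key : ‖a • (k • (C • x + S • y)) + s • (C • y - S • x)‖ ^ 2
      - ‖k • (C • x + S • y)‖ ^ 2 =
      s * (lam * ‖y‖ ^ 2 - (lam + s * (k ^ 2 - 1)) * ‖x‖ ^ 2) := by
    simp only [← real_inner_self_eq_norm_sq, inner_add_left, inner_sub_left,
      inner_sub_right, inner_add_right, real_inner_smul_left, real_inner_smul_right,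
      real_inner_comm x y]
    have ha2 : a ^ 2 = 1 - s ^ 2 := by linarith
    linear_combination (k ^ 2 * (C ^ 2 * ⟪x, x⟫ + 2 * C * S * ⟪x, y⟫ + S ^ 2 * ⟪y, y⟫)) * ha2
      + s * ⟪y, y⟫ * hlam + s * ⟪x, x⟫ * hmu + 2 * s * ⟪x, y⟫ * hcross
  rw [← sub_pos, key, mul_pos_iff_of_pos_left hs, sub_pos]

/-- The threshold for the ratio of squared norms to which the reduced error event corresponds, as a
function of `d = √(1 - a²) ρ β / 2` and `c = ρ β + 1`. -/
noncomputable def ratioThreshold (c d : ℝ) : ℝ := (√(d ^ 2 + c) + d) ^ 2 / c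

theorem ratioThreshold_strictMonoOn {c : ℝ} (hc : 0 < c) :
    StrictMonoOn (ratioThreshold c) (Set.Ici 0) := by
  intro d₁ h₁ d₂ h₂ h
  have h₁' : 0 ≤ d₁ := h₁
  unfold ratioThreshold
  have : √(d₁ ^ 2 + c) ≤ √(d₂ ^ 2 + c) := Real.sqrt_le_sqrt (by gcongr)
  gcongr

theorem reducedErrorProb_eq_normRatioTail (M : ℕ) {ρ β a : ℝ} (hρ : 0 < ρ) (hβ : 0 < β)
    (ha : a ∈ Set.Ico (0 : ℝ) 1) :
    reducedErrorProb M ρ β a =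
      normRatioTail M (ratioThreshold (ρ * β + 1) (√(1 - a ^ 2) * (ρ * β) / 2)) := by
  obtain ⟨ha₀, ha₁⟩ := ha
  have hs₂ : 0 < 1 - a ^ 2 := by nlinarith
  obtain ⟨s, hs⟩ : ∃ s, s = √(1 - a ^ 2) := ⟨_, rfl⟩
  have hs₀ : 0 < s := hs ▸ Real.sqrt_pos.2 hs₂
  have has : a ^ 2 + s ^ 2 = 1 := by rw [hs, Real.sq_sqrt hs₂.le]; ring
  have hρβ : 0 < ρ * β := mul_pos hρ hβ
  obtain ⟨k, hk₀, hk⟩ : ∃ k : ℝ, 0 < k ∧ k ^ 2 = ρ * β + 1 :=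
    ⟨√(ρ * β + 1), Real.sqrt_pos.2 (by positivity), Real.sq_sqrt (by positivity)⟩
  obtain ⟨d, hd⟩ : ∃ d, d = s * (ρ * β) / 2 := ⟨_, rfl⟩
  have hd₀ : 0 < d := by rw [hd]; positivity
  obtain ⟨R, hR⟩ : ∃ R, R = √(d ^ 2 + k ^ 2) := ⟨_, rfl⟩
  have hR₂ : R ^ 2 = d ^ 2 + k ^ 2 := by rw [hR, Real.sq_sqrt (by positivity)]
  have hRd : d < R := by rw [hR]; exact Real.lt_sqrt_of_sq_lt (by nlinarith)
  have hsd : s * (k ^ 2 - 1) = 2 * d := by rw [hk, hd]; ring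
  -- `R - d` is the positive root of `lam² + 2 d lam = k²`.
  obtain ⟨C, S, hCS, h₁, h₂, h₃⟩ := exists_rotation_diagonalizing (lam := R - d) has
    (sub_pos.2 hRd) hs₀ hk₀ (by rw [hsd]; linear_combination hR₂)
  have hset : MeasurableSet {p : EuclideanSpace ℂ (Fin M) × EuclideanSpace ℂ (Fin M) |
      ‖(a : ℂ) • p.1 + ((Real.sqrt (1 - a ^ 2) : ℝ) : ℂ) • p.2‖ ^ 2 > ‖p.1‖ ^ 2} :=
    (isOpen_lt (by fun_prop) (by fun_prop)).measurableSet
  rw [reducedErrorProb, normRatioTail, ← hk, ← map_rotation_complexNormalVec M k C S hCS,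
    map_measureReal_apply (by fun_prop) hset]
  congr 1
  ext g
  simp only [Set.mem_preimage, Set.mem_ofPred_eq, gt_iff_lt, Complex.coe_smul, ← hs, ← hd]
  rw [normSq_smul_add_smul_lt_iff has hs₀ h₁ h₂ h₃, hsd, ratioThreshold, ← hR]
  -- The fixed determinant turns the eigenvalue ratio into `ratioThreshold`, visibly increasing in
  -- `d`.
  have hprod : (R + d) * (R - d) = k ^ 2 := by linear_combination hR₂
  have hfac : (R + d) ^ 2 / k ^ 2 = (R + d) / (R - d) := by
    rw [← hprod, sq, mul_div_mul_left _ _ (by linarith)]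
  rw [hfac, div_mul_eq_mul_div, div_lt_iff₀ (sub_pos.2 hRd), mul_comm (‖g.2‖ ^ 2),
    show R - d + 2 * d = R + d by ring]

theorem reducedErrorProb_strictMonoOn {M : ℕ} (hM : 0 < M) {ρ β : ℝ} (hρ : 0 < ρ) (hβ : 0 < β) :
    StrictMonoOn (fun a : ℝ => reducedErrorProb M ρ β a) (Set.Ico 0 1) := by
  intro a ha b hb hab
  have hρβ : 0 < ρ * β := mul_pos hρ hβ
  have hs : √(1 - b ^ 2) < √(1 - a ^ 2) :=
    Real.sqrt_lt_sqrt (by nlinarith [hb.1, hb.2]) (by nlinarith [ha.1])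
  simp only [reducedErrorProb_eq_normRatioTail M hρ hβ ha,
    reducedErrorProb_eq_normRatioTail M hρ hβ hb]
  refine normRatioTail_strictAntiOn hM (Set.mem_Ici.2 (by unfold ratioThreshold; positivity))
    (Set.mem_Ici.2 (by unfold ratioThreshold; positivity)) ?_
  refine ratioThreshold_strictMonoOn (by positivity) (Set.mem_Ici.2 (by positivity))
    (Set.mem_Ici.2 (by positivity)) ?_
  gcongr

/-! ### Reduction of the pairwise error probability -/

/-- Up to a phase, conjugate sequences have a nonnegative real correlation. -/
theorem exists_conj_sequences {τ : ℕ} {φ φ' : EuclideanSpace ℂ (Fin τ)} (hφ : ‖φ‖ = 1)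
    (hφ' : ‖φ'‖ = 1) : ∃ p q : EuclideanSpace ℂ (Fin τ), ∃ w : ℂ,
      WithLp.ofLp p = star (WithLp.ofLp φ) ∧ WithLp.ofLp q = w • star (WithLp.ofLp φ') ∧
      ‖w‖ = 1 ∧ ‖p‖ = 1 ∧ ‖q‖ = 1 ∧ inner ℂ p q = (‖inner ℂ φ φ'‖ : ℂ) := by
  have hstar : ∀ ψ : EuclideanSpace ℂ (Fin τ),
      ‖(WithLp.toLp 2 (star (WithLp.ofLp ψ)) : EuclideanSpace ℂ (Fin τ))‖ = ‖ψ‖ := by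
    intro ψ
    simp [EuclideanSpace.norm_eq]
  have hinner : inner ℂ (WithLp.toLp 2 (star (WithLp.ofLp φ)) : EuclideanSpace ℂ (Fin τ))
      (WithLp.toLp 2 (star (WithLp.ofLp φ'))) = star (inner ℂ φ φ') := by
    simp [PiLp.inner_apply]
  obtain ⟨w, hw, hwα⟩ := Complex.exists_norm_eq_mul_self (star (inner ℂ φ φ'))
  refine ⟨WithLp.toLp 2 (star (WithLp.ofLp φ)), w • WithLp.toLp 2 (star (WithLp.ofLp φ')), w, rfl,
    rfl, hw, ?_, ?_, ?_⟩
  · rw [hstar, hφ]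
  · rw [norm_smul, hstar, hφ', hw, one_mul]
  · rw [inner_smul_right, hinner, ← hwα, norm_star]

/-- Gram-Schmidt for two unit vectors with a nonnegative correlation below one. -/
theorem exists_orthonormal_decomposition {E : Type*} [NormedAddCommGroup E] [InnerProductSpace ℂ E]
    {p q : E} {a : ℝ} (hp : ‖p‖ = 1) (hq : ‖q‖ = 1) (hpq : inner ℂ p q = (a : ℂ))
    (ha₀ : 0 ≤ a) (ha₁ : a < 1) :
    ∃ e : E, ‖e‖ = 1 ∧ inner ℂ p e = 0 ∧ q = (a : ℂ) • p + ((√(1 - a ^ 2) : ℝ) : ℂ) • e := by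
  have hs₂ : 0 < 1 - a ^ 2 := by nlinarith
  have hs₀ : 0 < √(1 - a ^ 2) := Real.sqrt_pos.2 hs₂
  have hn : ‖q - (a : ℂ) • p‖ = √(1 - a ^ 2) := by
    rw [eq_comm, Real.sqrt_eq_iff_eq_sq hs₂.le (norm_nonneg _), norm_sub_sq (𝕜 := ℂ),
      inner_smul_right, ← inner_conj_symm, hpq, norm_smul, hp, hq]
    simp
    ring
  refine ⟨((√(1 - a ^ 2) : ℝ) : ℂ)⁻¹ • (q - (a : ℂ) • p), ?_, ?_, ?_⟩
  · rw [norm_smul, hn, norm_inv, Complex.norm_of_nonneg hs₀.le, inv_mul_cancel₀ hs₀.ne']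
  · rw [inner_smul_right, inner_sub_right, inner_smul_right, hpq, inner_self_eq_norm_sq_to_K, hp]
    simp
  · rw [smul_inv_smul₀ (by exact_mod_cast hs₀.ne')]
    simp

theorem pairwiseErrorProb_eq {M τ : ℕ} {ρ β : ℝ} (hρ : 0 < ρ) (hβ : 0 < β)
    {Ω : Type*} [MeasurableSpace Ω] {P : Measure Ω} [IsProbabilityMeasure P]
    {z : Ω → EuclideanSpace ℂ (Fin M)} {W : Ω → Matrix (Fin M) (Fin τ) ℂ}
    (hz : HasLaw z (complexNormalVec M 1) P) (hW : HasLaw W (noiseLaw M τ) P)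
    (hzW : IndepFun z W P) {h : Ω → EuclideanSpace ℂ (Fin M)}
    (hh : ∀ ω, h ω = ((Real.sqrt β : ℝ) : ℂ) • z ω)
    {φ φ' : EuclideanSpace ℂ (Fin τ)} (hφ : ‖φ‖ = 1) (hφ' : ‖φ'‖ = 1) :
    pairwiseErrorProb P ρ h W φ φ' = reducedErrorProb M ρ β ‖inner ℂ φ φ'‖ := by
  obtain ⟨p, q, w, hpφ, hqφ', hw, hp, hq, hpq⟩ := exists_conj_sequences hφ hφ'
  obtain ⟨a, ha⟩ : ∃ a, a = ‖inner ℂ φ φ'‖ := ⟨_, rfl⟩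
  have ha₁ : a ≤ 1 := by simpa [ha, hφ, hφ'] using norm_inner_le_norm (𝕜 := ℂ) φ φ'
  rw [← ha] at hpq ⊢
  have ha₀ : 0 ≤ a := ha ▸ norm_nonneg _
  have hobj : ∀ Y : Matrix (Fin M) (Fin τ) ℂ, detectorObjective Y φ =
      ‖(WithLp.toLp 2 (Y *ᵥ WithLp.ofLp p) : EuclideanSpace ℂ (Fin M))‖ := fun Y => by
    rw [detectorObjective, hpφ]
  have hobj' : ∀ Y : Matrix (Fin M) (Fin τ) ℂ, detectorObjective Y φ' =
      ‖(WithLp.toLp 2 (Y *ᵥ WithLp.ofLp q) : EuclideanSpace ℂ (Fin M))‖ := fun Y => by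
    rw [detectorObjective, hqφ', Matrix.mulVec_smul, WithLp.toLp_smul, norm_smul, hw, one_mul]
  rw [pairwiseErrorProb]
  simp only [hobj, hobj']
  -- For `a = 1` no vector `e` is needed: `p = q`, and both strict inequalities are impossible.
  rcases ha₁.eq_or_lt with rfl | ha₁
  · have hqp : p = q := (inner_eq_one_iff_of_norm_eq_one hp hq).1 (by simpa using hpq)
    simp [hqp, reducedErrorProb]
  obtain ⟨e, he, hpe, hqe⟩ := exists_orthonormal_decomposition hp hq hpq ha₀ ha₁
  have hdot : ∀ u : EuclideanSpace ℂ (Fin τ),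
      WithLp.ofLp φ ⬝ᵥ WithLp.ofLp u = inner ℂ p u := by
    intro u
    rw [EuclideanSpace.inner_eq_star_dotProduct, hpφ, star_star, dotProduct_comm]
  have hrec : ∀ ω (u : EuclideanSpace ℂ (Fin τ)),
      (WithLp.toLp 2 (receivedSignal ρ (h ω) φ (W ω) *ᵥ WithLp.ofLp u) :
        EuclideanSpace ℂ (Fin M)) =
      inner ℂ p u • (√(ρ * β) • z ω) + WithLp.toLp 2 (W ω *ᵥ WithLp.ofLp u) := by
    intro ω u
    rw [receivedSignal, Matrix.add_mulVec, Matrix.smul_mulVec, Matrix.vecMulVec_mulVec, hdot, hh,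
      Real.sqrt_mul hρ.le]
    ext i
    simp
    ring
  have hlaw : HasLaw (fun ω => (√(ρ * β) • z ω + WithLp.toLp 2 (W ω *ᵥ WithLp.ofLp p),
      (WithLp.toLp 2 (W ω *ᵥ WithLp.ofLp e) : EuclideanSpace ℂ (Fin M))))
      ((complexNormalVec M (ρ * β + 1)).prod (complexNormalVec M 1)) P := by
    have hmap := map_projections M τ (√(ρ * β)) hp he hpe
    rw [Real.sq_sqrt (by positivity)] at hmap
    exact HasLaw.fun_comp ⟨(measurable_projections _ p e).aemeasurable, hmap⟩ (hzW.hasLaw_prod hz hW)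
  have hset : MeasurableSet {p : EuclideanSpace ℂ (Fin M) × EuclideanSpace ℂ (Fin M) |
      ‖(a : ℂ) • p.1 + ((Real.sqrt (1 - a ^ 2) : ℝ) : ℂ) • p.2‖ ^ 2 > ‖p.1‖ ^ 2} :=
    (isOpen_lt (by fun_prop) (by fun_prop)).measurableSet
  rw [reducedErrorProb, ← hlaw.measureReal_eq hset]
  congr 1
  ext ω
  have hYp := hrec ω p
  have hYe := hrec ω e
  rw [inner_self_eq_norm_sq_to_K, hp] at hYp
  rw [hpe, zero_smul, zero_add] at hYe
  have hYq : (WithLp.toLp 2 (receivedSignal ρ (h ω) φ (W ω) *ᵥ WithLp.ofLp q) :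
        EuclideanSpace ℂ (Fin M)) =
      (a : ℂ) • WithLp.toLp 2 (receivedSignal ρ (h ω) φ (W ω) *ᵥ WithLp.ofLp p) +
      ((√(1 - a ^ 2) : ℝ) : ℂ) •
        WithLp.toLp 2 (receivedSignal ρ (h ω) φ (W ω) *ᵥ WithLp.ofLp e) := by
    rw [hqe, WithLp.ofLp_add, WithLp.ofLp_smul, WithLp.ofLp_smul, Matrix.mulVec_add,
      Matrix.mulVec_smul, Matrix.mulVec_smul, WithLp.toLp_add, WithLp.toLp_smul, WithLp.toLp_smul]
  simp only [Set.mem_ofPred_eq, gt_iff_lt]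
  rw [hYq, hYe, hYp, RCLike.ofReal_one, one_pow, one_smul,
    pow_lt_pow_iff_left₀ (norm_nonneg _) (norm_nonneg _) two_ne_zero]

theorem mainTheorem4 (M τ : ℕ) (hM : 0 < M) (ρ β : ℝ) (hρ : 0 < ρ) (hβ : 0 < β)
    {Ω : Type*} [MeasurableSpace Ω] (P : Measure Ω) [IsProbabilityMeasure P]
    (z : Ω → EuclideanSpace ℂ (Fin M)) (W : Ω → Matrix (Fin M) (Fin τ) ℂ)
    (hz : HasLaw z (complexNormalVec M 1) P) (hW : HasLaw W (noiseLaw M τ) P)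
    (hzW : IndepFun z W P)
    (h : Ω → EuclideanSpace ℂ (Fin M))
    (hh : ∀ ω, h ω = ((Real.sqrt β : ℝ) : ℂ) • z ω) :
    (∀ φ φ' : EuclideanSpace ℂ (Fin τ), ‖φ‖ = 1 → ‖φ'‖ = 1 →
      pairwiseErrorProb P ρ h W φ φ' = reducedErrorProb M ρ β ‖inner ℂ φ φ'‖) ∧
    StrictMonoOn (fun a : ℝ => reducedErrorProb M ρ β a) (Set.Ico 0 1) ∧
    (∀ φ₁ φ₁' φ₂ φ₂' : EuclideanSpace ℂ (Fin τ),
      ‖φ₁‖ = 1 → ‖φ₁'‖ = 1 → ‖φ₂‖ = 1 → ‖φ₂'‖ = 1 →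
      ‖inner ℂ φ₁ φ₁'‖ < ‖inner ℂ φ₂ φ₂'‖ → ‖inner ℂ φ₂ φ₂'‖ < 1 →
      pairwiseErrorProb P ρ h W φ₁ φ₁' < pairwiseErrorProb P ρ h W φ₂ φ₂') := by
  refine ⟨fun φ φ' hφ hφ' => pairwiseErrorProb_eq hρ hβ hz hW hzW hh hφ hφ',
    reducedErrorProb_strictMonoOn hM hρ hβ, fun φ₁ φ₁' φ₂ φ₂' h₁ h₁' h₂ h₂' hlt hlt1 => ?_⟩
  rw [pairwiseErrorProb_eq hρ hβ hz hW hzW hh h₁ h₁',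
    pairwiseErrorProb_eq hρ hβ hz hW hzW hh h₂ h₂']
  exact reducedErrorProb_strictMonoOn hM hρ hβ ⟨norm_nonneg _, hlt.trans hlt1⟩
    ⟨norm_nonneg _, hlt1⟩ hlt
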